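/- **Theorem B (higher-order Chen–Stein inequality).** There exists a universal constant $C \leq 570$ with the following property. Let $n \geq 1$ and $r \geq 1$ be integers, let $p_1,\ldots,p_n \in (0,1)$, let $Y_1,\ldots,Y_n$ be independent Bernoulli random variables with $\mathbb{P}[Y_i=1]=p_i=1-\mathbb{P}[Y_i=0]$, and let $\mu_n$ be the law of $X_n=\sum_{i=1}^n Y_i$. Set $$\lambda_n=\sum_{i=1}^n p_i,\qquad \sigma_n=\Big(\sum_{i=1}^n p_i^2\Big)^{1/2},\qquad \eta_n=\frac{4\sqrt{\mathrm{e}}\,\sigma_n}{\sqrt{\lambda_n}},$$ and assume that $\lambda_n>16\,\mathrm{e}\,\sigma_n^2$. Let $(b_{s,n})_{s\geq 1}$ be the real coefficients of the convergent expansion $$\mathbb{E}[\mathrm{e}^{\mathrm{i}\xi X_n}]\,\mathrm{e}^{-\lambda_n(\mathrm{e}^{\mathrm{i}\xi}-1)}=1+\sum_{s=1}^\infty b_{s,n}\,(\mathrm{e}^{\mathrm{i}\xi}-1)^s\qquad(\xi\in\mathbb{R}).$$ Then $\eta_n<1$; there is a unique signed measure $\nu_n^{(r)}$ on $\mathbb{N}=\{0,1,2,\ldots\}$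 (the approximation scheme of order $r$ of $\mu_n$) such that $$\sum_{k=0}^\infty \nu_n^{(r)}(k)\,\mathrm{e}^{\mathrm{i}k\xi}=\mathrm{e}^{\lambda_n(\mathrm{e}^{\mathrm{i}\xi}-1)}\Big(1+\sum_{s=1}^r b_{s,n}\,(\mathrm{e}^{\mathrm{i}\xi}-1)^s\Big)\qquad(\xi\in\mathbb{R});$$ and $$d_{\mathrm{TV}}(\mu_n,\nu_n^{(r)})=\frac12\sum_{k=0}^\infty\big|\mathbb{P}[X_n=k]-\nu_n^{(r)}(k)\big|\;\leq\; C\,\eta_n^{\,r+1}.$$ -/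

import Mathlib

open MeasureTheory ProbabilityTheory

/-- Fourier transform `ξ ↦ ∑ₖ ν({k}) e^{ikξ}` of a signed measure on `ℕ`
(the series converges absolutely, since a signed measure is finite). -/
noncomputable def signedFourier (ν : SignedMeasure ℕ) (ξ : ℝ) : ℂ :=
  ∑' k : ℕ, (ν {k} : ℂ) * Complex.exp (Complex.I * k * ξ)

/-- Residue of deconvolution of a law `μ` on `ℕ` by the Poisson law of parameter `lam`:
`ψ(ξ) = 𝔼[e^{iξX}] e^{-lam (e^{iξ} - 1)}`, where `X` has law `μ`. -/
noncomputable def poissonResidue (μ : Measure ℕ) (lam ξ : ℝ) : ℂ :=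
  (∫ k : ℕ, Complex.exp (Complex.I * ξ * k) ∂μ) *
    Complex.exp (-(lam * (Complex.exp (Complex.I * ξ) - 1)))

/-- The residue of `μ` is given by the convergent power series
`ψ(ξ) = 1 + ∑_{s ≥ 1} b_s (e^{iξ} - 1)^s` with real coefficients `b_s`; by convention `b_0 = 1`. -/
def IsResidueExpansion (μ : Measure ℕ) (lam : ℝ) (b : ℕ → ℝ) : Prop :=
  b 0 = 1 ∧ ∀ ξ : ℝ,
    HasSum (fun s : ℕ => (b s : ℂ) * (Complex.exp (Complex.I * ξ) - 1) ^ s)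
      (poissonResidue μ lam ξ)

/-- `ν` is the approximation scheme of order `r` of the law `μ`, with Poisson parameter `lam`:
its Fourier transform is that of the Poisson law of parameter `lam`, times the truncation
at order `r` of the power series of the residue of `μ`. -/
def IsApproximationScheme (μ : Measure ℕ) (lam : ℝ) (r : ℕ) (ν : SignedMeasure ℕ) : Prop :=
  ∃ b : ℕ → ℝ, IsResidueExpansion μ lam b ∧ ∀ ξ : ℝ,
    signedFourier ν ξ =
      Complex.exp (lam * (Complex.exp (Complex.I * ξ) - 1)) *
        (1 + ∑ s ∈ Finset.Icc 1 r, (b s : ℂ) * (Complex.exp (Complex.I * ξ) - 1) ^ s)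

/-- Total variation distance `½ ∑ₖ |μ({k}) - ν({k})|` between a probability measure and a
signed measure on `ℕ`. -/
noncomputable def dTV (μ : Measure ℕ) (ν : SignedMeasure ℕ) : ℝ :=
  (1 / 2) * ∑' k : ℕ, |μ.real {k} - ν {k}|

namespace PowerSeries

/-- The weighted `ℓ¹` norm `∑ₖ |aₖ| ρᵏ` of a real power series is finite and at most `c`. -/
def NormLE (F : PowerSeries ℝ) (ρ c : ℝ) : Prop :=
  Summable (fun k => |coeff k F| * ρ ^ k) ∧ ∑' k, |coeff k F| * ρ ^ k ≤ c

/-- The sum of a real power series at a complex point. -/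
noncomputable def cEval (F : PowerSeries ℝ) (z : ℂ) : ℂ := ∑' k, ((coeff k F : ℝ) : ℂ) * z ^ k

variable {F G : PowerSeries ℝ} {ρ c d : ℝ} {z : ℂ}

theorem normLE_of_hasSum {a : ℕ → ℝ} (ha : HasSum a c)
    (h : ∀ k, |coeff k F| * ρ ^ k ≤ a k) (hρ : 0 ≤ ρ) : NormLE F ρ c := by
  have hs : Summable (fun k => |coeff k F| * ρ ^ k) :=
    ha.summable.of_nonneg_of_le (fun k => by positivity) h
  exact ⟨hs, hasSum_le h hs.hasSum ha⟩

theorem NormLE.nonneg (hF : NormLE F ρ c) (hρ : 0 ≤ ρ) : 0 ≤ c :=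
  (tsum_nonneg fun k => by positivity).trans hF.2

theorem NormLE.abs_coeff_mul_le (hF : NormLE F ρ c) (hρ : 0 ≤ ρ) (k : ℕ) :
    |coeff k F| * ρ ^ k ≤ c :=
  (hF.1.le_tsum k fun j _ => by positivity).trans hF.2

theorem NormLE.summable_norm (hF : NormLE F ρ c) (hz : ‖z‖ ≤ ρ) :
    Summable (fun k => ‖((coeff k F : ℝ) : ℂ) * z ^ k‖) := by
  refine hF.1.of_nonneg_of_le (fun k => norm_nonneg _) fun k => ?_
  rw [norm_mul, norm_pow, Complex.norm_real, Real.norm_eq_abs]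
  gcongr

theorem NormLE.hasSum_cEval (hF : NormLE F ρ c) (hz : ‖z‖ ≤ ρ) :
    HasSum (fun k => ((coeff k F : ℝ) : ℂ) * z ^ k) (cEval F z) :=
  (hF.summable_norm hz).of_norm.hasSum

theorem NormLE.mul (hF : NormLE F ρ c) (hG : NormLE G ρ d) (hρ : 0 ≤ ρ) :
    NormLE (F * G) ρ (c * d) := by
  set f : ℕ → ℝ := fun k => |coeff k F| * ρ ^ k
  set g : ℕ → ℝ := fun k => |coeff k G| * ρ ^ k
  have hf0 : ∀ k, 0 ≤ f k := fun k => by positivity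
  have hg0 : ∀ k, 0 ≤ g k := fun k => by positivity
  have hf : Summable fun k => ‖f k‖ := by simpa only [Real.norm_of_nonneg (hf0 _)] using hF.1
  have hg : Summable fun k => ‖g k‖ := by simpa only [Real.norm_of_nonneg (hg0 _)] using hG.1
  have hs := (summable_norm_sum_mul_antidiagonal_of_summable_norm hf hg).of_norm.hasSum
  rw [← tsum_mul_tsum_eq_tsum_sum_antidiagonal_of_summable_norm hf hg] at hs
  have hle : ∀ k, |coeff k (F * G)| * ρ ^ k ≤
      ∑ kl ∈ Finset.HasAntidiagonal.antidiagonal k, f kl.1 * g kl.2 := by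
    intro k
    rw [coeff_mul]
    calc |∑ kl ∈ Finset.HasAntidiagonal.antidiagonal k, coeff kl.1 F * coeff kl.2 G| * ρ ^ k
        ≤ (∑ kl ∈ Finset.HasAntidiagonal.antidiagonal k, |coeff kl.1 F * coeff kl.2 G|) * ρ ^ k := by
          gcongr; exact Finset.abs_sum_le_sum_abs _ _
      _ = _ := by
          rw [Finset.sum_mul]
          refine Finset.sum_congr rfl fun kl hkl => ?_
          rw [← Finset.HasAntidiagonal.mem_antidiagonal.mp hkl, abs_mul, pow_add]
          simp only [f, g]; ring
  have := normLE_of_hasSum hs hle hρ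
  exact ⟨this.1, this.2.trans (mul_le_mul hF.2 hG.2 (tsum_nonneg hg0) (hF.nonneg hρ))⟩

theorem normLE_one : NormLE 1 ρ 1 := by
  have h : (fun k => |coeff k (1 : PowerSeries ℝ)| * ρ ^ k) = fun k => if k = 0 then 1 else 0 := by
    ext k; by_cases hk : k = 0 <;> simp [coeff_one, hk]
  exact ⟨h ▸ (hasSum_ite_eq 0 1).summable, by rw [h, (hasSum_ite_eq 0 (1 : ℝ)).tsum_eq]⟩

theorem NormLE.pow (hF : NormLE F ρ c) (hρ : 0 ≤ ρ) (s : ℕ) : NormLE (F ^ s) ρ (c ^ s) := by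
  induction s with
  | zero => simpa using normLE_one
  | succ s ih => rw [pow_succ, pow_succ]; exact ih.mul hF hρ

theorem NormLE.prod {ι : Type*} (t : Finset ι) {F : ι → PowerSeries ℝ} {c : ι → ℝ}
    (hF : ∀ i, NormLE (F i) ρ (c i)) (hρ : 0 ≤ ρ) :
    NormLE (∏ i ∈ t, F i) ρ (∏ i ∈ t, c i) := by
  classical
  induction t using Finset.induction_on with
  | empty => simpa using normLE_one
  | insert a t ha ih => rw [Finset.prod_insert ha, Finset.prod_insert ha]; exact (hF a).mul ih hρ

theorem cEval_one : cEval 1 z = 1 := by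
  rw [cEval, tsum_eq_single 0 fun k hk => by simp [coeff_one, hk]]; simp

theorem NormLE.cEval_mul (hF : NormLE F ρ c) (hG : NormLE G ρ d) (hz : ‖z‖ ≤ ρ) :
    cEval (F * G) z = cEval F z * cEval G z := by
  rw [cEval, cEval, cEval, tsum_mul_tsum_eq_tsum_sum_antidiagonal_of_summable_norm
    (hF.summable_norm hz) (hG.summable_norm hz)]
  refine tsum_congr fun k => ?_
  rw [coeff_mul, Complex.ofReal_sum, Finset.sum_mul]
  refine Finset.sum_congr rfl fun kl hkl => ?_
  rw [← Finset.HasAntidiagonal.mem_antidiagonal.mp hkl, pow_add]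
  push_cast; ring

theorem NormLE.cEval_pow (hF : NormLE F ρ c) (hz : ‖z‖ ≤ ρ) (s : ℕ) :
    cEval (F ^ s) z = cEval F z ^ s := by
  have hρ := (norm_nonneg z).trans hz
  induction s with
  | zero => simpa using cEval_one
  | succ s ih => rw [pow_succ, pow_succ, (hF.pow hρ s).cEval_mul hF hz, ih]

theorem NormLE.cEval_prod {ι : Type*} (t : Finset ι) {F : ι → PowerSeries ℝ} {c : ι → ℝ}
    (hF : ∀ i, NormLE (F i) ρ (c i)) (hz : ‖z‖ ≤ ρ) :
    cEval (∏ i ∈ t, F i) z = ∏ i ∈ t, cEval (F i) z := by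
  classical
  have hρ := (norm_nonneg z).trans hz
  induction t using Finset.induction_on with
  | empty => simpa using cEval_one
  | insert a t ha ih =>
    rw [Finset.prod_insert ha, Finset.prod_insert ha, (hF a).cEval_mul (NormLE.prod t hF hρ) hz, ih]

theorem coeff_rescale_exp (t : ℝ) (k : ℕ) :
    coeff k (rescale t (exp ℝ)) = t ^ k / k.factorial := by
  simp [coeff_rescale, coeff_exp, div_eq_mul_inv]

theorem normLE_rescale_exp (t : ℝ) (hρ : 0 ≤ ρ) :
    NormLE (rescale t (exp ℝ)) ρ (Real.exp (|t| * ρ)) := by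
  refine normLE_of_hasSum (a := fun k => (|t| * ρ) ^ k / k.factorial) ?_ (fun k => ?_) hρ
  · rw [Real.exp_eq_exp_ℝ]; exact NormedSpace.expSeries_div_hasSum_exp _
  · rw [coeff_rescale_exp, abs_div, abs_pow, Nat.abs_cast, mul_pow]
    exact le_of_eq (by ring)

theorem cEval_rescale_exp (t : ℝ) (z : ℂ) :
    cEval (rescale t (exp ℝ)) z = Complex.exp (t * z) := by
  have h : HasSum (fun k : ℕ => ((t : ℂ) * z) ^ k / k.factorial) (Complex.exp (t * z)) := by
    rw [Complex.exp_eq_exp_ℂ]; exact NormedSpace.expSeries_div_hasSum_exp _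
  rw [cEval, ← h.tsum_eq]
  refine tsum_congr fun k => ?_
  rw [coeff_rescale_exp]; push_cast; rw [mul_pow]; ring

theorem hasSum_pow_div_factorial (x : ℝ) :
    HasSum (fun k : ℕ => x ^ k / k.factorial) (Real.exp x) := by
  rw [Real.exp_eq_exp_ℝ]; exact NormedSpace.expSeries_div_hasSum_exp _

theorem hasSum_mul_pow_div_factorial (x : ℝ) :
    HasSum (fun k : ℕ => k * (x ^ k / k.factorial)) (x * Real.exp x) := by
  rw [← hasSum_nat_add_iff' 1]
  convert (hasSum_pow_div_factorial x).mul_left x using 1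
  · rfl
  · funext k
    rw [Nat.factorial_succ]; push_cast
    have : (k.factorial : ℝ) ≠ 0 := by positivity
    field_simp
    ring
  · simp

theorem hasSum_sq_mul_pow_div_factorial (x : ℝ) :
    HasSum (fun k : ℕ => (k : ℝ) ^ 2 * (x ^ k / k.factorial)) ((x ^ 2 + x) * Real.exp x) := by
  rw [← hasSum_nat_add_iff' 1]
  convert ((hasSum_mul_pow_div_factorial x).add (hasSum_pow_div_factorial x)).mul_left x using 1
  · rfl
  · funext k
    rw [Nat.factorial_succ]; push_cast
    have : (k.factorial : ℝ) ≠ 0 := by positivity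
    field_simp
    ring
  · simp; ring

theorem normLE_X_sub_one : NormLE (X - 1) 1 2 := by
  have hs : HasSum (fun k => (if k = 0 then 1 else 0) + (if k = 1 then 1 else 0) : ℕ → ℝ) (1 + 1) :=
    (hasSum_ite_eq 0 (1 : ℝ)).add (hasSum_ite_eq 1 (1 : ℝ))
  rw [show (2 : ℝ) = 1 + 1 by norm_num]
  refine normLE_of_hasSum hs (fun k => ?_) zero_le_one
  rw [map_sub, coeff_X, coeff_one]
  rcases k with _ | _ | k <;> simp

theorem cEval_X_sub_one (z : ℂ) : cEval (X - 1) z = z - 1 := by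
  rw [cEval, tsum_eq_sum (s := Finset.range 2)]
  · simp [Finset.sum_range_succ, coeff_X, coeff_one]; ring
  · intro k hk
    rw [Finset.mem_range, not_lt] at hk
    simp [coeff_X, coeff_one, show k ≠ 1 by omega, show k ≠ 0 by omega]

/-- The generating series `e^{t (X - 1)}` of the Poisson law of parameter `t`. -/
noncomputable def poissonSeries (t : ℝ) : PowerSeries ℝ :=
  Real.exp (-t) • rescale t (exp ℝ)

theorem coeff_poissonSeries (t : ℝ) (k : ℕ) :
    coeff k (poissonSeries t) = Real.exp (-t) * (t ^ k / k.factorial) := by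
  rw [poissonSeries, coeff_smul, coeff_rescale_exp, smul_eq_mul]

theorem poissonSeries_mul (s t : ℝ) :
    poissonSeries s * poissonSeries t = poissonSeries (s + t) := by
  rw [poissonSeries, poissonSeries, poissonSeries, smul_mul_smul_comm, exp_mul_exp_eq_exp_add,
    ← Real.exp_add, neg_add]

theorem poissonSeries_pow (t : ℝ) (s : ℕ) : poissonSeries t ^ s = poissonSeries (s * t) := by
  induction s with
  | zero => ext k; cases k <;> simp [coeff_poissonSeries, coeff_one]
  | succ s ih => rw [pow_succ, ih, poissonSeries_mul]; push_cast; ring_nf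

theorem normLE_poissonSeries {t : ℝ} (ht : 0 ≤ t) : NormLE (poissonSeries t) 1 1 := by
  have h := (hasSum_pow_div_factorial t).mul_left (Real.exp (-t))
  rw [← Real.exp_add, neg_add_cancel, Real.exp_zero] at h
  refine normLE_of_hasSum h (fun k => ?_) zero_le_one
  rw [coeff_poissonSeries, abs_of_nonneg (by positivity), one_pow, mul_one]

theorem cEval_poissonSeries (t : ℝ) (z : ℂ) :
    cEval (poissonSeries t) z = Complex.exp (t * (z - 1)) := by
  have : cEval (poissonSeries t) z = (Real.exp (-t) : ℂ) * cEval (rescale t (exp ℝ)) z := by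
    rw [cEval, cEval, ← tsum_mul_left]
    refine tsum_congr fun k => ?_
    rw [coeff_poissonSeries, coeff_rescale_exp]; push_cast; ring
  rw [this, cEval_rescale_exp, Complex.ofReal_exp, ← Complex.exp_add]
  congr 1; push_cast; ring

theorem normLE_X_sub_one_mul_poissonSeries {t : ℝ} (ht : 0 < t) :
    NormLE ((X - 1) * poissonSeries t) 1 (√t)⁻¹ := by
  have h0 := (hasSum_pow_div_factorial t).mul_left (Real.exp (-t))
  have h1 := (hasSum_mul_pow_div_factorial t).mul_left (Real.exp (-t))
  have h2 := (hasSum_sq_mul_pow_div_factorial t).mul_left (Real.exp (-t))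
  have hst : 0 < √t := Real.sqrt_pos.mpr ht
  have hs := (((h2.mul_left (1 / t ^ 2)).sub (h1.mul_left (2 / t))).add h0).mul_left (√t / 2)
    |>.add (h0.mul_left ((√t)⁻¹ / 2))
  have hE : Real.exp (-t) * Real.exp t = 1 := by rw [← Real.exp_add]; simp
  have hval : √t / 2 * (1 / t ^ 2 * (Real.exp (-t) * ((t ^ 2 + t) * Real.exp t)) -
      2 / t * (Real.exp (-t) * (t * Real.exp t)) + Real.exp (-t) * Real.exp t) +
      (√t)⁻¹ / 2 * (Real.exp (-t) * Real.exp t) = (√t)⁻¹ := by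
    rw [show Real.exp (-t) * ((t ^ 2 + t) * Real.exp t) =
      (t ^ 2 + t) * (Real.exp (-t) * Real.exp t) by ring,
      show Real.exp (-t) * (t * Real.exp t) = t * (Real.exp (-t) * Real.exp t) by ring, hE]
    have : √t / t = (√t)⁻¹ := Real.sqrt_div_self'.trans (one_div _)
    rw [show √t / 2 * (1 / t ^ 2 * ((t ^ 2 + t) * 1) - 2 / t * (t * 1) + 1) = (√t / t) / 2 by
      field_simp; ring, this]
    ring
  rw [hval] at hs
  refine normLE_of_hasSum hs (fun k => ?_) zero_le_one
  set π := Real.exp (-t) * (t ^ k / k.factorial) with hπ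
  have hπ0 : 0 ≤ π := by positivity
  have hc : coeff k ((X - 1) * poissonSeries t) = π * (k / t - 1) := by
    rw [sub_mul, one_mul, map_sub, coeff_poissonSeries]
    rcases k with _ | k
    · simp [hπ]
    · rw [coeff_succ_X_mul, coeff_poissonSeries, hπ, Nat.factorial_succ]
      have : (k.factorial : ℝ) ≠ 0 := by positivity
      push_cast; field_simp
      ring
  rw [hc, abs_mul, abs_of_nonneg hπ0, one_pow, mul_one]
  have key : |(k : ℝ) / t - 1| ≤ √t / 2 * (k / t - 1) ^ 2 + (√t)⁻¹ / 2 := by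
    set x := (k : ℝ) / t - 1
    rw [← sq_abs x]
    have : √t / 2 * |x| ^ 2 + (√t)⁻¹ / 2 - |x| = (√t)⁻¹ / 2 * (√t * |x| - 1) ^ 2 := by
      field_simp; ring
    have h0 : 0 ≤ (√t)⁻¹ / 2 * (√t * |x| - 1) ^ 2 := by positivity
    linarith
  calc π * |(k : ℝ) / t - 1| ≤ π * (√t / 2 * (k / t - 1) ^ 2 + (√t)⁻¹ / 2) := by gcongr
    _ = _ := by rw [hπ]; field_simp; ring

theorem normLE_X_sub_one_pow_mul_poissonSeries {t : ℝ} (ht : 0 < t) {s : ℕ} (hs : 1 ≤ s) :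
    NormLE ((X - 1) ^ s * poissonSeries t) 1 (√(s / t) ^ s) := by
  have hs0 : (0 : ℝ) < s := by exact_mod_cast hs
  have h := (normLE_X_sub_one_mul_poissonSeries (div_pos ht hs0)).pow zero_le_one s
  rwa [mul_pow, poissonSeries_pow, mul_div_cancel₀ _ hs0.ne', ← Real.sqrt_inv, inv_div] at h

theorem cEval_X_sub_one_pow_mul_poissonSeries {t : ℝ} (ht : 0 ≤ t) (s : ℕ) (hz : ‖z‖ ≤ 1) :
    cEval ((X - 1) ^ s * poissonSeries t) z = (z - 1) ^ s * Complex.exp (t * (z - 1)) := by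
  rw [(normLE_X_sub_one.pow zero_le_one s).cEval_mul (normLE_poissonSeries ht) hz,
    normLE_X_sub_one.cEval_pow hz, cEval_X_sub_one, cEval_poissonSeries]

/-- The power series `(1 + p X) e^{-p X}`. -/
noncomputable def bernoulliResidue (p : ℝ) : PowerSeries ℝ :=
  (1 + p • X) * rescale (-p) (exp ℝ)

theorem coeff_bernoulliResidue (p : ℝ) (k : ℕ) :
    coeff k (bernoulliResidue p) = (1 - k) * ((-p) ^ k / k.factorial) := by
  rw [bernoulliResidue, add_mul, one_mul, smul_mul_assoc, map_add, coeff_smul, coeff_rescale_exp]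
  rcases k with _ | k
  · simp
  · rw [coeff_succ_X_mul, coeff_rescale_exp, Nat.factorial_succ, smul_eq_mul]
    have : (k.factorial : ℝ) ≠ 0 := by positivity
    push_cast; field_simp; ring

theorem two_add_sub_one_mul_exp_le {x : ℝ} (hx : 0 ≤ x) :
    x * Real.exp x - Real.exp x + 2 ≤ Real.exp (x ^ 2) := by
  have h1 := Real.quadratic_le_exp_of_nonneg hx
  have h2 : Real.exp x * (x * (x - 1) + 1) ≤ Real.exp (x ^ 2) := by
    rw [show x ^ 2 = x + x * (x - 1) by ring, Real.exp_add]
    gcongr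
    exact Real.add_one_le_exp _
  have h3 : (1 + x + x ^ 2 / 2) * (x ^ 2 - 2 * x + 2) ≤ Real.exp x * (x ^ 2 - 2 * x + 2) := by
    gcongr
    nlinarith [sq_nonneg (x - 1)]
  have h4 : (1 + x + x ^ 2 / 2) * (x ^ 2 - 2 * x + 2) = 2 + x ^ 4 / 2 := by ring
  have h5 : 0 ≤ x ^ 4 := by positivity
  linarith

theorem normLE_bernoulliResidue {p : ℝ} (hp : 0 ≤ p) (hρ : 0 ≤ ρ) :
    NormLE (bernoulliResidue p) ρ (Real.exp ((p * ρ) ^ 2)) := by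
  have hs := ((hasSum_mul_pow_div_factorial (p * ρ)).sub (hasSum_pow_div_factorial (p * ρ))).add
    (hasSum_ite_eq 0 (2 : ℝ))
  have h : NormLE (bernoulliResidue p) ρ (p * ρ * Real.exp (p * ρ) - Real.exp (p * ρ) + 2) := by
    refine normLE_of_hasSum hs (fun k => ?_) hρ
    rw [coeff_bernoulliResidue]
    rcases k with _ | k
    · simp; norm_num
    · rw [abs_mul, abs_div, abs_pow, abs_neg, abs_of_nonneg hp, Nat.abs_cast, mul_pow,
        abs_of_nonpos (by push_cast; linarith [(Nat.cast_nonneg k : (0 : ℝ) ≤ k)])]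
      refine le_of_eq ?_
      simp
      ring
  exact ⟨h.1, h.2.trans (two_add_sub_one_mul_exp_le (by positivity))⟩

theorem cEval_bernoulliResidue (p : ℝ) (z : ℂ) :
    cEval (bernoulliResidue p) z = (1 + p * z) * Complex.exp (-(p * z)) := by
  have hz0 := norm_nonneg z
  have hc : ∀ k, coeff k (1 + p • X : PowerSeries ℝ) =
      if k = 0 then 1 else if k = 1 then p else 0 := by
    intro k; rcases k with _ | _ | k <;> simp [coeff_X, coeff_one]
  have hfin : ∀ k ∉ Finset.range 2, coeff k (1 + p • X : PowerSeries ℝ) = 0 := by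
    intro k hk
    rw [Finset.mem_range, not_lt] at hk
    rw [hc, if_neg (by omega), if_neg (by omega)]
  have h1 : NormLE (1 + p • X) ‖z‖ (∑' k, |coeff k (1 + p • X : PowerSeries ℝ)| * ‖z‖ ^ k) :=
    ⟨summable_of_ne_finset_zero (s := Finset.range 2) fun k hk => by simp [hfin k hk], le_rfl⟩
  rw [bernoulliResidue, h1.cEval_mul (normLE_rescale_exp _ hz0) le_rfl, cEval_rescale_exp, cEval,
    tsum_eq_sum (s := Finset.range 2) fun k hk => by simp [hfin k hk]]
  simp [Finset.sum_range_succ, hc]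

end PowerSeries

theorem eq_zero_of_hasSum_exp_sub_one_pow {d : ℕ → ℂ}
    (h : ∀ ξ : ℝ, HasSum (fun s => d s * (Complex.exp (Complex.I * ξ) - 1) ^ s) 0) : d = 0 := by
  set q := FormalMultilinearSeries.ofScalars ℂ d
  have happ : ∀ (w : ℂ) (s : ℕ), q s (fun _ => w) = d s * w ^ s := fun w s => by
    simp [q, mul_comm]
  have hrad : ((1 : NNReal) : ENNReal) ≤ q.radius := by
    have h1 := (h Real.pi).summable.tendsto_atTop_zero.norm
    rw [norm_zero] at h1
    refine q.le_radius_of_tendsto (squeeze_zero (fun s => by positivity) (fun s => ?_) h1)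
    rw [mul_comm Complex.I, Complex.exp_pi_mul_I, FormalMultilinearSeries.ofScalars_norm, norm_mul,
      norm_pow]
    gcongr
    norm_num
  have hpos : 0 < q.radius := lt_of_lt_of_le (by simp) hrad
  have hq : HasFPowerSeriesAt q.sum q 0 := (q.hasFPowerSeriesOnBall hpos).hasFPowerSeriesAt
  have hzero : ∀ ξ : ℝ, q.sum (Complex.exp (Complex.I * ξ) - 1) = 0 := fun ξ => by
    rw [FormalMultilinearSeries.sum, ← (h ξ).tsum_eq]
    exact tsum_congr fun s => happ _ s
  have hmap : Filter.Tendsto (fun ξ : ℝ => Complex.exp (Complex.I * ξ) - 1)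
      (nhdsWithin 0 {0}ᶜ) (nhdsWithin 0 {0}ᶜ) := by
    have hder : HasDerivAt (fun ξ : ℝ => Complex.exp (Complex.I * ξ) - 1) Complex.I 0 := by
      have h1 : HasDerivAt (fun ξ : ℝ => Complex.I * (ξ : ℂ)) (Complex.I * 1) 0 :=
        (HasDerivAt.ofReal_comp (hasDerivAt_id (0 : ℝ))).const_mul _
      simpa using h1.cexp.sub_const 1
    simpa using hder.tendsto_nhdsNE Complex.I_ne_zero
  have hfreq : ∃ᶠ w in nhdsWithin (0 : ℂ) {0}ᶜ, q.sum w = 0 :=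
    hmap.frequently (Filter.Eventually.of_forall hzero).frequently
  have hev := (hq.analyticAt.frequently_zero_iff_eventually_zero).mp hfreq
  exact FormalMultilinearSeries.ofScalars_series_eq_zero ℂ |>.mp (hq.eq_zero_of_eventually hev)

theorem IsResidueExpansion.unique {μ : Measure ℕ} {lam : ℝ} {b b' : ℕ → ℝ}
    (hb : IsResidueExpansion μ lam b) (hb' : IsResidueExpansion μ lam b') : b = b' := by
  have h := eq_zero_of_hasSum_exp_sub_one_pow (d := fun s => (b s : ℂ) - b' s) fun ξ => by
    simpa only [sub_mul, sub_self] using (hb.2 ξ).sub (hb'.2 ξ)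
  funext s
  have := congrFun h s
  simp only [Pi.zero_apply, sub_eq_zero] at this
  exact_mod_cast this

theorem eq_zero_of_tsum_mul_exp_eq_zero {a : ℕ → ℂ} (ha : Summable fun k => ‖a k‖)
    (h : ∀ ξ : ℝ, ∑' k : ℕ, a k * Complex.exp (Complex.I * k * ξ) = 0) : a = 0 := by
  funext j
  have hcont : ∀ k : ℕ, Continuous fun ξ : ℝ =>
      a k * Complex.exp (Complex.I * ((k : ℂ) - j) * ξ) := fun k => by fun_prop
  have hnorm : ∀ (k : ℕ) (ξ : ℝ),
      ‖a k * Complex.exp (Complex.I * ((k : ℂ) - j) * ξ)‖ = ‖a k‖ := fun k ξ => by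
    rw [norm_mul, show Complex.I * ((k : ℂ) - j) * ξ = (((k : ℝ) - j) * ξ : ℝ) * Complex.I by
      push_cast; ring, Complex.norm_exp_ofReal_mul_I, mul_one]
  have hsum := intervalIntegral.hasSum_integral_of_dominated_convergence
    (μ := volume) (a := 0) (b := 2 * Real.pi)
    (F := fun (k : ℕ) (ξ : ℝ) => a k * Complex.exp (Complex.I * ((k : ℂ) - j) * ξ))
    (f := fun _ => 0) (bound := fun k _ => ‖a k‖)
    (fun k => (hcont k).aestronglyMeasurable)
    (fun k => Filter.Eventually.of_forall fun ξ _ => (hnorm k ξ).le)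
    (Filter.Eventually.of_forall fun _ _ => ha)
    intervalIntegrable_const
    (Filter.Eventually.of_forall fun ξ _ => by
      have hs : Summable fun k => a k * Complex.exp (Complex.I * ((k : ℂ) - j) * ξ) :=
        Summable.of_norm (by simpa only [hnorm] using ha)
      refine hs.hasSum_iff.mpr (Eq.symm ?_)
      have h0 := congrArg (· * Complex.exp (-(Complex.I * j * ξ))) (h ξ)
      simp only [zero_mul] at h0
      rw [← h0, ← tsum_mul_right]
      refine tsum_congr fun k => ?_
      rw [mul_assoc, ← Complex.exp_add]
      congr 2; ring)
  have hint : ∀ k : ℕ, ∫ ξ in (0 : ℝ)..2 * Real.pi,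
      a k * Complex.exp (Complex.I * ((k : ℂ) - j) * ξ) =
        if k = j then a j * (2 * Real.pi) else 0 := fun k => by
    split_ifs with hk
    · subst hk; simp [mul_comm]
    · have hne : Complex.I * ((k : ℂ) - j) ≠ 0 :=
        mul_ne_zero Complex.I_ne_zero (sub_ne_zero.mpr (by exact_mod_cast hk))
      rw [intervalIntegral.integral_const_mul, integral_exp_mul_complex hne]
      have : Complex.exp (Complex.I * ((k : ℂ) - j) * ((2 * Real.pi : ℝ) : ℂ)) = 1 :=
        Complex.exp_eq_one_iff.mpr ⟨(k : ℤ) - j, by push_cast; ring⟩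
      rw [this]; simp
  simp only [hint] at hsum
  have := hsum.unique (hasSum_ite_eq j (a j * (2 * Real.pi)))
  rw [intervalIntegral.integral_zero] at this
  have hpi : (2 * Real.pi : ℂ) ≠ 0 := by exact_mod_cast Real.two_pi_pos.ne'
  simpa [hpi] using this.symm

namespace MeasureTheory.SignedMeasure

theorem hasSum_singleton (ν : SignedMeasure ℕ) (s : Set ℕ) :
    HasSum (fun k => ν (s ∩ {k})) (ν s) := by
  have h := ν.hasSum_of_disjoint_iUnion (f := fun k : ℕ => s ∩ {k})
    (fun _ => MeasurableSet.of_discrete)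
    (fun i j hij => Set.disjoint_left.mpr fun x hi hj => hij (hi.2.symm.trans hj.2))
  have hU : ⋃ k : ℕ, s ∩ {k} = s := by ext x; simp
  rwa [hU] at h

theorem summable_norm_singleton (ν : SignedMeasure ℕ) : Summable fun k => ‖ν {k}‖ := by
  have h := (hasSum_singleton ν Set.univ).summable.norm
  simpa only [Set.univ_inter] using h

theorem ext_singleton {ν ν' : SignedMeasure ℕ} (h : ∀ k, ν {k} = ν' {k}) : ν = ν' := by
  refine VectorMeasure.ext fun s _ => ?_
  refine (hasSum_singleton ν s).unique ?_
  convert hasSum_singleton ν' s using 2 with k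
  by_cases hk : k ∈ s
  · rw [Set.inter_eq_right.mpr (Set.singleton_subset_iff.mpr hk), h]
  · rw [Set.inter_singleton_eq_empty.mpr hk, VectorMeasure.empty, VectorMeasure.empty]

end MeasureTheory.SignedMeasure

theorem signedFourier_injective : Function.Injective signedFourier := by
  intro ν ν' h
  have hn : ∀ (ν : SignedMeasure ℕ) (ξ : ℝ),
      Summable fun k : ℕ => (ν {k} : ℂ) * Complex.exp (Complex.I * k * ξ) := fun ν ξ => by
    refine Summable.of_norm ?_
    convert ν.summable_norm_singleton using 2 with k
    rw [norm_mul, show Complex.I * k * ξ = ((k * ξ : ℝ) : ℂ) * Complex.I by push_cast; ring,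
      Complex.norm_exp_ofReal_mul_I, mul_one, Complex.norm_real]
  have h0 := eq_zero_of_tsum_mul_exp_eq_zero (a := fun k => (ν {k} : ℂ) - ν' {k})
    (by
      refine (ν.summable_norm_singleton.add ν'.summable_norm_singleton).of_nonneg_of_le
        (fun _ => norm_nonneg _) fun k => (norm_sub_le _ _).trans (by simp))
    (fun ξ => by
      simp only [sub_mul]
      rw [(hn ν ξ).tsum_sub (hn ν' ξ), sub_eq_zero]
      exact congrFun h ξ)
  refine SignedMeasure.ext_singleton fun k => ?_
  have := congrFun h0 k
  simp only [Pi.zero_apply, sub_eq_zero] at this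
  exact_mod_cast this

theorem IsApproximationScheme.unique {μ : Measure ℕ} {lam : ℝ} {r : ℕ} {ν ν' : SignedMeasure ℕ}
    (h : IsApproximationScheme μ lam r ν) (h' : IsApproximationScheme μ lam r ν') : ν = ν' := by
  obtain ⟨b, hb, hν⟩ := h
  obtain ⟨b', hb', hν'⟩ := h'
  obtain rfl := hb.unique hb'
  exact signedFourier_injective (funext fun ξ => (hν ξ).trans (hν' ξ).symm)

open PowerSeries in
theorem poissonResidue_sum_bernoulli {Ω : Type*} [MeasurableSpace Ω] {P : Measure Ω} {n : ℕ}
    {p : Fin n → unitInterval} {Y : Fin n → Ω → ℕ}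
    (hind : iIndepFun Y P) (hlaw : ∀ i, HasLaw (Y i) (bernoulliMeasure 1 0 (p i)) P) (ξ : ℝ) :
    poissonResidue (P.map (fun ω => ∑ i, Y i ω)) (∑ i, (p i : ℝ)) ξ =
      cEval (∏ i, bernoulliResidue (p i)) (Complex.exp (Complex.I * ξ) - 1) := by
  have hY : ∀ i, AEMeasurable (Y i) P := fun i => (hlaw i).aemeasurable
  set w := Complex.exp (Complex.I * ξ) - 1 with hw
  have hone : ∀ i, ∫ ω, Complex.exp (Complex.I * ξ * (Y i ω : ℕ)) ∂P = 1 + (p i : ℝ) * w := by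
    intro i
    rw [← integral_map (f := fun k : ℕ => Complex.exp (Complex.I * ξ * k)) (hY i)
      (by fun_prop), (hlaw i).map_eq, integral_bernoulliMeasure]
    simp [hw]; ring
  have hint : ∫ k : ℕ, Complex.exp (Complex.I * ξ * k) ∂(P.map (fun ω => ∑ i, Y i ω)) =
      ∏ i, (1 + (p i : ℝ) * w) := by
    rw [integral_map (by fun_prop) (by fun_prop), ← Finset.prod_congr rfl fun i _ => hone i,
      ← hind.integral_fun_prod_comp (f := fun _ k => Complex.exp (Complex.I * ξ * (k : ℕ))) hY
        (fun i => by fun_prop)]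
    refine integral_congr_ae (Filter.Eventually.of_forall fun ω => ?_)
    simp only
    rw [← Complex.exp_sum]
    push_cast
    rw [Finset.mul_sum]
  rw [poissonResidue, hint, ← hw, NormLE.cEval_prod Finset.univ
    (fun i => normLE_bernoulliResidue (p i).2.1 (norm_nonneg w)) le_rfl]
  simp only [cEval_bernoulliResidue]
  rw [Finset.prod_mul_distrib, ← Complex.exp_sum, Finset.sum_neg_distrib, Complex.ofReal_sum,
    Finset.sum_mul]

open PowerSeries in
theorem isResidueExpansion_sum_bernoulli {Ω : Type*} [MeasurableSpace Ω] {P : Measure Ω} {n : ℕ}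
    {p : Fin n → unitInterval} {Y : Fin n → Ω → ℕ}
    (hind : iIndepFun Y P) (hlaw : ∀ i, HasLaw (Y i) (bernoulliMeasure 1 0 (p i)) P) :
    IsResidueExpansion (P.map (fun ω => ∑ i, Y i ω)) (∑ i, (p i : ℝ))
      fun s => coeff s (∏ i, bernoulliResidue (p i)) := by
  refine ⟨?_, fun ξ => ?_⟩
  · beta_reduce
    rw [coeff_zero_eq_constantCoeff_apply, map_prod]
    refine Finset.prod_eq_one fun i _ => ?_
    rw [← coeff_zero_eq_constantCoeff_apply, coeff_bernoulliResidue]; simp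
  · rw [poissonResidue_sum_bernoulli hind hlaw]
    exact (NormLE.prod Finset.univ
      (fun i => normLE_bernoulliResidue (p i).2.1 (norm_nonneg _)) (norm_nonneg _)).hasSum_cEval
      le_rfl

open PowerSeries in
theorem abs_coeff_prod_bernoulliResidue_le {n : ℕ} {p : Fin n → ℝ} (hp : ∀ i, 0 ≤ p i)
    (hS : 0 < ∑ i, p i ^ 2) {s : ℕ} (hs : 1 ≤ s) :
    |coeff s (∏ i, bernoulliResidue (p i))| ≤ √(2 * Real.exp 1 * (∑ i, p i ^ 2) / s) ^ s := by
  set S := ∑ i, p i ^ 2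
  have hs0 : (0 : ℝ) < s := by exact_mod_cast hs
  set ρ := √(s / (2 * S)) with hρdef
  have hρ : 0 < ρ := Real.sqrt_pos.mpr (by positivity)
  have hρsq : ρ ^ 2 = s / (2 * S) := Real.sq_sqrt (by positivity)
  have h := (NormLE.prod Finset.univ (fun i => normLE_bernoulliResidue (hp i) hρ.le)
    hρ.le).abs_coeff_mul_le hρ.le s
  have hexp : ∏ i, Real.exp ((p i * ρ) ^ 2) = √(Real.exp 1) ^ s := by
    rw [← Real.exp_sum, ← Real.exp_half, ← Real.exp_nat_mul]
    congr 1
    simp only [mul_pow]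
    rw [← Finset.sum_mul, hρsq]
    change S * _ = _
    field_simp
  rw [hexp, ← le_div_iff₀ (pow_pos hρ s), ← div_pow, hρdef, ← Real.sqrt_div' _ (by positivity)] at h
  refine h.trans_eq ?_
  congr 2
  field_simp

theorem poissonResidue_mul_exp (μ : Measure ℕ) (lam ξ : ℝ) :
    Complex.exp (lam * (Complex.exp (Complex.I * ξ) - 1)) * poissonResidue μ lam ξ =
      ∫ k : ℕ, Complex.exp (Complex.I * ξ * k) ∂μ := by
  rw [poissonResidue, mul_left_comm, ← Complex.exp_add, add_neg_cancel, Complex.exp_zero, mul_one]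

open PowerSeries in
theorem exists_isApproximationScheme_dTV_le {μ : Measure ℕ} [IsProbabilityMeasure μ] {lam q : ℝ}
    (hlam : 0 < lam) {b : ℕ → ℝ} (hb : IsResidueExpansion μ lam b) (hq0 : 0 ≤ q) (hq1 : q < 1)
    (hbq : ∀ s : ℕ, 1 ≤ s → |b s| * √(s / lam) ^ s ≤ q ^ s) (r : ℕ) :
    ∃ ν : SignedMeasure ℕ, IsApproximationScheme μ lam r ν ∧
      dTV μ ν ≤ 1 / 2 * (q ^ (r + 1) / (1 - q)) := by
  set f : ℕ × ℕ → ℝ := fun x =>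
    b (x.1 + (r + 1)) * coeff x.2 ((X - 1) ^ (x.1 + (r + 1)) * poissonSeries lam) with hf
  have hT : ∀ s : ℕ, NormLE ((X - 1) ^ (s + (r + 1)) * poissonSeries lam) 1
      (√((s + (r + 1) : ℕ) / lam) ^ (s + (r + 1))) := fun s =>
    normLE_X_sub_one_pow_mul_poissonSeries hlam (by omega)
  have hrow : ∀ s, Summable fun k => ‖f (s, k)‖ := fun s => by
    have := (hT s).1.mul_left |b (s + (r + 1))|
    simp only [one_pow, mul_one, ← abs_mul] at this
    exact this
  have hrow_le : ∀ s, ∑' k, ‖f (s, k)‖ ≤ q ^ (r + 1) * q ^ s := fun s => by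
    have h := (hT s).2
    simp only [one_pow, mul_one] at h
    simp only [hf, norm_mul, Real.norm_eq_abs]
    rw [tsum_mul_left, ← pow_add, add_comm (r + 1)]
    exact (mul_le_mul_of_nonneg_left h (abs_nonneg _)).trans (hbq _ (by omega))
  have hgeom : HasSum (fun s => q ^ (r + 1) * q ^ s) (q ^ (r + 1) / (1 - q)) := by
    rw [div_eq_mul_inv]; exact (hasSum_geometric_of_lt_one hq0 hq1).mul_left _
  have hrows : Summable fun s => ∑' k, ‖f (s, k)‖ :=
    hgeom.summable.of_nonneg_of_le (fun s => tsum_nonneg fun k => norm_nonneg _) hrow_le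
  have hfn : Summable fun x => ‖f x‖ :=
    (summable_prod_of_nonneg fun _ => norm_nonneg _).mpr ⟨hrow, hrows⟩
  have hcol : ∀ k, Summable fun s => ‖f (s, k)‖ := fun k =>
    hfn.comp_injective (i := fun s : ℕ => (s, k)) fun _ _ h => (Prod.mk.inj h).1
  have hfn' : Summable fun x : ℕ × ℕ => ‖f (x.2, x.1)‖ := hfn.prod_symm
  set d : ℕ → ℝ := fun k => ∑' s, f (s, k) with hd
  have hd_le : ∀ k, ‖d k‖ ≤ ∑' s, ‖f (s, k)‖ := fun k => norm_tsum_le_tsum_norm (hcol k)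
  have hcols : Summable fun k => ∑' s, ‖f (s, k)‖ := hfn'.prod
  have hdsum : Summable fun k => ‖d k‖ :=
    hcols.of_nonneg_of_le (fun k => norm_nonneg _) hd_le
  have hdtsum : ∑' k, ‖d k‖ ≤ q ^ (r + 1) / (1 - q) := by
    refine (hdsum.tsum_le_tsum hd_le hcols).trans ?_
    rw [← Summable.tsum_comm (f := fun k s => ‖f (s, k)‖) hfn', ← hgeom.tsum_eq]
    exact hrows.tsum_le_tsum hrow_le hgeom.summable
  have hdint : Integrable d Measure.count := integrable_count_iff.mpr hdsum
  set ν : SignedMeasure ℕ := μ.toSignedMeasure - Measure.count.withDensityᵥ d with hν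
  have hνk : ∀ k, ν {k} = μ.real {k} - d k := fun k => by
    rw [hν, sub_apply, Measure.toSignedMeasure_apply_measurable (by simp),
      withDensityᵥ_apply hdint (by simp)]
    simp
  refine ⟨ν, ⟨b, hb, fun ξ => ?_⟩, ?_⟩
  · set z := Complex.exp (Complex.I * ξ) with hz
    have hz1 : ‖z‖ = 1 := by rw [hz, mul_comm, Complex.norm_exp_ofReal_mul_I]
    have hzk : ∀ k : ℕ, Complex.exp (Complex.I * k * ξ) = z ^ k := fun k => by
      rw [hz, ← Complex.exp_nat_mul]; congr 1; ring
    have hμint : Integrable (fun k : ℕ => z ^ k) μ :=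
      (integrable_const (1 : ℝ)).mono' (by fun_prop)
        (Filter.Eventually.of_forall fun k => by simp [hz1])
    have hμsum : HasSum (fun k : ℕ => (μ.real {k} : ℂ) * z ^ k)
        (Complex.exp (lam * (z - 1)) * poissonResidue μ lam ξ) := by
      have h1 : ∫ k : ℕ, Complex.exp (Complex.I * ξ * k) ∂μ = ∑' k : ℕ, (μ.real {k} : ℂ) * z ^ k := by
        rw [← integral_congr_ae (Filter.Eventually.of_forall fun k : ℕ => (by
          rw [← hzk]; congr 1; ring : z ^ k = Complex.exp (Complex.I * ξ * k))),
          integral_countable hμint]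
        simp
      rw [hz, poissonResidue_mul_exp, h1]
      refine Summable.hasSum (Summable.of_norm ?_)
      have := μ.toSignedMeasure.summable_norm_singleton
      refine this.congr fun k => ?_
      rw [norm_mul, norm_pow, hz1, one_pow, mul_one, Complex.norm_real,
        Measure.toSignedMeasure_apply_measurable (by simp)]
    have hfz : Summable fun x : ℕ × ℕ => (f (x.2, x.1) : ℂ) * z ^ x.1 := by
      refine Summable.of_norm (hfn'.congr fun x => Eq.symm ?_)
      rw [norm_mul, norm_pow, hz1, one_pow, mul_one, Complex.norm_real]
    have hdz : ∑' k, (d k : ℂ) * z ^ k = ∑' s : ℕ,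
        Complex.exp (lam * (z - 1)) * ((b (s + (r + 1)) : ℂ) * (z - 1) ^ (s + (r + 1))) := by
      calc ∑' k, (d k : ℂ) * z ^ k = ∑' k, ∑' s, (f (s, k) : ℂ) * z ^ k := by
            refine tsum_congr fun k => ?_
            rw [hd, Complex.ofReal_tsum, tsum_mul_right]
        _ = ∑' s, ∑' k, (f (s, k) : ℂ) * z ^ k :=
            (Summable.tsum_comm (f := fun k s => (f (s, k) : ℂ) * z ^ k) hfz).symm
        _ = _ := by
            refine tsum_congr fun s => ?_
            have hc := cEval_X_sub_one_pow_mul_poissonSeries hlam.le (s + (r + 1)) hz1.le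
            rw [cEval] at hc
            simp only [hf, Complex.ofReal_mul, mul_assoc]
            rw [tsum_mul_left, hc]
            ring
    have hdzs : Summable fun k => (d k : ℂ) * z ^ k := by
      refine Summable.of_norm (hdsum.congr fun k => ?_)
      rw [norm_mul, norm_pow, hz1, one_pow, mul_one, Complex.norm_real]
    have htail := (hasSum_nat_add_iff' (r + 1)).mpr (hb.2 ξ)
    rw [signedFourier]
    simp only [hνk, hzk, Complex.ofReal_sub, sub_mul]
    rw [hμsum.summable.tsum_sub hdzs, hμsum.tsum_eq, hdz, tsum_mul_left, htail.tsum_eq,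
      Finset.range_eq_Ico, Finset.sum_eq_sum_Ico_succ_bot (by omega), hb.1]
    rw [show Finset.Ico (0 + 1) (r + 1) = Finset.Icc 1 r from rfl]
    simp only [Complex.ofReal_one, pow_zero, mul_one]
    ring
  · rw [dTV]
    have : ∀ k, |μ.real {k} - ν {k}| = ‖d k‖ := fun k => by
      rw [hνk, sub_sub_cancel, Real.norm_eq_abs]
    simp only [this]
    gcongr

theorem theoremB :
    ∃ C : ℝ, C ≤ 570 ∧
      ∀ (Ω : Type*) [MeasurableSpace Ω] (P : Measure Ω) [IsProbabilityMeasure P]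
        (n : ℕ) (p : Fin n → unitInterval) (Y : Fin n → Ω → ℕ) (lam σ η : ℝ) (r : ℕ),
        (∀ i, 0 < p i ∧ p i < 1) →
        iIndepFun Y P →
        (∀ i, HasLaw (Y i) (bernoulliMeasure 1 0 (p i)) P) →
        lam = ∑ i, (p i : ℝ) →
        σ = √(∑ i, (p i : ℝ) ^ 2) →
        lam > 16 * Real.exp 1 * σ ^ 2 →
        η = 4 * √(Real.exp 1) * σ / √lam →
        1 ≤ r →
        η < 1 ∧
        (∃! ν : SignedMeasure ℕ,
          IsApproximationScheme (P.map (fun ω => ∑ i, Y i ω)) lam r ν) ∧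
        ∀ ν : SignedMeasure ℕ,
          IsApproximationScheme (P.map (fun ω => ∑ i, Y i ω)) lam r ν →
          dTV (P.map (fun ω => ∑ i, Y i ω)) ν ≤ C * η ^ (r + 1) := by
  refine ⟨1, by norm_num, ?_⟩
  intro Ω _ P _ n p Y lam σ η r hp hind hlaw hlam hσ hbig hη _
  have hY : ∀ i, AEMeasurable (Y i) P := fun i => (hlaw i).aemeasurable
  have : IsProbabilityMeasure (P.map (fun ω => ∑ i, Y i ω)) :=
    Measure.isProbabilityMeasure_map (by fun_prop)
  have hp0 : ∀ i, 0 < (p i : ℝ) := fun i => (hp i).1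
  have hlam0 : 0 < lam := lt_of_le_of_lt (by positivity) hbig
  have hn : (Finset.univ : Finset (Fin n)).Nonempty := by
    by_contra h
    rw [Finset.not_nonempty_iff_eq_empty] at h
    rw [hlam, h, Finset.sum_empty] at hlam0
    exact hlam0.false
  set S := ∑ i, (p i : ℝ) ^ 2 with hS
  have hS0 : 0 < S := Finset.sum_pos (fun i _ => pow_pos (hp0 i) 2) hn
  have hσ0 : 0 ≤ σ := hσ ▸ Real.sqrt_nonneg _
  have hσsq : σ ^ 2 = S := by rw [hσ, Real.sq_sqrt hS0.le]
  have hη0 : 0 ≤ η := by rw [hη]; positivity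
  have hηsq : η ^ 2 = 16 * Real.exp 1 * S / lam := by
    rw [hη, div_pow, mul_pow, mul_pow, Real.sq_sqrt (Real.exp_pos 1).le, Real.sq_sqrt hlam0.le,
      hσsq]
    norm_num
  have hη1 : η < 1 := by
    have : η ^ 2 < 1 := by rw [hηsq, div_lt_one hlam0, ← hσsq]; exact hbig
    nlinarith
  have hb := isResidueExpansion_sum_bernoulli hind hlaw
  rw [← hlam] at hb
  have hbq : ∀ s : ℕ, 1 ≤ s →
      |PowerSeries.coeff s (∏ i, PowerSeries.bernoulliResidue (p i))| * √(s / lam) ^ s ≤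
        (η / 2) ^ s := fun s hs => by
    have hs0 : (0 : ℝ) < s := by exact_mod_cast hs
    have h := abs_coeff_prod_bernoulliResidue_le (fun i => (hp0 i).le) hS0 hs
    refine (mul_le_mul_of_nonneg_right h (by positivity)).trans ?_
    rw [← mul_pow, ← Real.sqrt_mul (by positivity)]
    gcongr
    refine Real.sqrt_le_iff.mpr ⟨by positivity, ?_⟩
    rw [div_pow, hηsq, ← hS]
    have h1 : 2 * Real.exp 1 * S / s * (s / lam) = 2 * (Real.exp 1 * S / lam) := by field_simp
    have h2 : 16 * Real.exp 1 * S / lam / 2 ^ 2 = 4 * (Real.exp 1 * S / lam) := by ring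
    have h3 : 0 ≤ Real.exp 1 * S / lam := by positivity
    rw [h1, h2]; linarith
  obtain ⟨ν, hν, hTV⟩ := exists_isApproximationScheme_dTV_le hlam0 hb (q := η / 2)
    (by positivity) (by linarith) hbq r
  refine ⟨hη1, ⟨ν, hν, fun ν' hν' => hν'.unique hν⟩, fun ν' hν' => ?_⟩
  rw [hν'.unique hν, one_mul]
  refine hTV.trans ?_
  have h1 : (η / 2) ^ (r + 1) ≤ η ^ (r + 1) := by gcongr; linarith
  have h2 : (η / 2) ^ (r + 1) / (1 - η / 2) ≤ 2 * (η / 2) ^ (r + 1) := by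
    rw [div_le_iff₀ (by linarith)]
    have : 0 ≤ (η / 2) ^ (r + 1) := by positivity
    nlinarith
  linarith
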